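/- Let $\Delta$ be the space of pairs $(f,h)$ of probability measures on $\mathbb N=\{0,1,2,\dots\}$, with the $\sigma$-algebra generated by the maps $(f,h)\mapsto f(\{j\})$ and $(f,h)\mapsto h(\{j\})$, $j\in\mathbb N$. Write $f(0)=f(\{0\})$, $h(0)=h(\{0\})$ and $\mathfrak m(f)=\sum_{j\ge 0} j f(\{j\})$. Let $\mathbf Q=(f,h)$ be a $\Delta$-valued random variable (the components $f$ and $h$ may be dependent), and let $\xi=(\mathbf Q_1,\mathbf Q_2,\dots)$, $\mathbf Q_n=(f_n,h_n)$, be a sequence of independent copies of $\mathbf Q$. A branching process with immigration in the random environment $\xi$ started from $k\ge 1$ individuals is an $\mathbb N$-valued process $(Z_n)_{n\ge 0}$ with $Z_0=k$ which, given $\xi$, is a Markov chain such that the conditional law of $Z_n$ given $Z_{n-1}=z$ and $\xi$ is the law of $N_{n,1}+\dots+N_{n,z}+Y_n$, where $N_{n,1},\dots,N_{n,z},Y_n$ are independent, each $N_{n,i}$ has law $f_n$ and $Y_n$ has law $h_n$. Denote by $\mathbb P_k$ the (annealed) probability for the process started from $Z_0=k$. Assume that $0<\mathfrak m(f)<\infty$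 almost surely, that $\mathbb E\log \mathfrak m(f)\in(0,\infty)$, and that $\mathbb P(h(0)<1)>0$. Assume further: (A) $\mathbb P\big(h(0)>0,\ f(0)>0,\ f(\{1\})>0\big)>0$; (B) there is a constant $\delta\in(0,1)$ such that $f(0)<\delta$ almost surely. **Theorem.** There is a constant $\varrho\in(-\infty,0)$, depending only on the law of $\mathbf Q$, such that for all integers $k,j\ge 1$, $$\lim_{n\to\infty}\frac1n\log\mathbb P_k(Z_n=j)=\varrho .$$ Moreover, for every sequence $(k_n)$ of real numbers such that $k_n\ge 1$ for all large $n$ and $k_n/n\to 0$ as $n\to\infty$, $$\lim_{n\to\infty}\frac1n\log\mathbb P_1(1\le Z_n\le k_n)=\varrho .$$ -/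

import Mathlib

open MeasureTheory ProbabilityTheory Filter Topology
open scoped ENNReal

namespace BPIRE

/-- The space `Δ` of pairs `(f, h)` of probability measures on `ℕ`: `f` is an offspring law and `h`
an immigration law. Its σ-algebra is the product of the σ-algebras generated by the evaluations
`ν ↦ ν A`; as `ℕ` is countable, this is the Borel σ-algebra of the total variation metric. -/
abbrev Env : Type := ProbabilityMeasure ℕ × ProbabilityMeasure ℕ

/-- The mean `𝔪(f) = ∑ j, j * f {j}` of the offspring law, as an element of `[0, ∞]`. -/
noncomputable def offspringMean (q : Env) : ℝ≥0∞ :=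
  ∑' j : ℕ, (j : ℝ≥0∞) * (q.1 : Measure ℕ) {j}

/-- The law of `N₁ + ⋯ + N_z + Y`, where `N₁, …, N_z, Y` are independent, each `Nᵢ` has law `f` and
`Y` has law `h`, for `q = (f, h)`. -/
noncomputable def stepLaw (q : Env) (z : ℕ) : Measure ℕ :=
  ((Measure.pi fun _ : Fin z => (q.1 : Measure ℕ)).prod (q.2 : Measure ℕ)).map
    fun p => (∑ i, p.1 i) + p.2

/-- The σ-algebra generated by the whole environment `(Q 0, Q 1, …)` and by `Z 0, …, Z n`. -/
abbrev past {Ω : Type*} (Q : ℕ → Ω → Env) (Z : ℕ → Ω → ℕ) (n : ℕ) : MeasurableSpace Ω :=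
  (⨆ i, MeasurableSpace.comap (Q i) inferInstance) ⊔
    ⨆ i : Fin (n + 1), MeasurableSpace.comap (Z i) inferInstance

/-- `Z` is, on the probability space `(Ω, P)`, a branching process with immigration in the random
environment `Q`, started from `k` individuals, where the components of the environment are i.i.d.
with law `μ`. Here `Q n` governs the passage from generation `n` to generation `n + 1`
(in one-based indexing it is the `(n + 1)`-st component of the environment). -/
structure IsBPIRE {Ω : Type*} [MeasurableSpace Ω] (P : Measure Ω) (μ : Measure Env) (k : ℕ)
    (Q : ℕ → Ω → Env) (Z : ℕ → Ω → ℕ) : Prop where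
  measurable_env : ∀ n, Measurable (Q n)
  law_env : ∀ n, P.map (Q n) = μ
  indep_env : iIndepFun Q P
  measurable_process : ∀ n, Measurable (Z n)
  init : ∀ᵐ ω ∂P, Z 0 ω = k
  /-- Given the environment, `Z` is a Markov chain whose transition law from `z` at time `n`
  is `stepLaw (Q n) z`. -/
  markov : ∀ n j : ℕ,
    P⟦Z (n + 1) ⁻¹' {j} | past Q Z n⟧ =ᵐ[P] fun ω => (stepLaw (Q n ω) (Z n ω)).real {j}

end BPIRE

/-!
Averaging over the i.i.d. environment turns `Z` into a Markov chain on `ℕ` with transition matrix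
`trans μ`, so `P (Z n = j) = iter μ n k j` is an entry of a matrix power (`measure_process_eq`).
By (A) and supercriticality all states communicate and `1` is aperiodic, so Fekete's lemma, applied
to the supermultiplicative sequence `iter μ n 1 1`, yields a rate `ϱ` which all entries share
(`tendsto_log_iter`). The event `1 ≤ Z n ≤ k_n` has the same rate: by (A) the chain
jumps from `z` to `1` with probability at least `c * ε ^ (z + 1)` (`exists_le_trans`), which is
`exp (-o(n))` for `z ≤ k_n = o(n)`.

The substance is `ϱ < 0`. For large `z` the next population is close to `z * 𝔪(f)`, or larger, so
`z ↦ z ^ (-s)` is multiplied on average by at most about `E 𝔪(f) ^ (-s)`. This is less than `1` for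
small `s > 0`, because `E log 𝔪(f) > 0` while `𝔪(f) ≥ 1 - δ` by (B). To make this rigorous, replace
`z ^ (-s)` by the Beta integral `∫ u in (0, 1), (1 - u) ^ z * u ^ (s - 1)`, to which one step
of the chain applies through the generating function of `f`. After the substitution `u = v / z`,
dominated convergence gives the limit of the contraction ratio (`exists_lyapunov_contraction`); the
domination `f̂(1 - v / z) ^ z ≤ exp (-(1 - δ) v)` is again (B). Contraction above a level `z₀`,
together with the possibility of escaping from below `z₀`, gives
geometric decay of `iter μ n 1 1` along a progression (`exists_iter_le_pow`), hence `ϱ < 0`.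
-/

namespace BPIRE

/-! ### The one-step law -/

instance (q : Env) (z : ℕ) : IsProbabilityMeasure (stepLaw q z) :=
  Measure.isProbabilityMeasure_map (by fun_prop)

lemma measurable_offspring (j : ℕ) : Measurable fun q : Env => (q.1 : Measure ℕ) {j} :=
  (Measure.measurable_coe (measurableSet_singleton j)).comp
    (measurable_subtype_coe.comp measurable_fst)

lemma measurable_immigration (j : ℕ) : Measurable fun q : Env => (q.2 : Measure ℕ) {j} :=
  (Measure.measurable_coe (measurableSet_singleton j)).comp
    (measurable_subtype_coe.comp measurable_snd)

lemma measurable_offspringMean : Measurable offspringMean :=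
  Measurable.tsum fun j => (measurable_offspring j).const_mul _

lemma lintegral_stepLaw (q : Env) (z : ℕ) (g : ℕ → ℝ≥0∞) :
    ∫⁻ j, g j ∂(stepLaw q z) = ∑' w : (Fin z → ℕ) × ℕ,
      g ((∑ i, w.1 i) + w.2) * ((∏ i, (q.1 : Measure ℕ) {w.1 i}) * (q.2 : Measure ℕ) {w.2}) := by
  rw [stepLaw, lintegral_map (by fun_prop) (by fun_prop), lintegral_countable']
  refine tsum_congr fun w => ?_
  rw [← Set.singleton_prod_singleton, Measure.prod_prod, Measure.pi_singleton]

lemma stepLaw_singleton (q : Env) (z j : ℕ) :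
    stepLaw q z {j} = ∑' w : (Fin z → ℕ) × ℕ,
      ({j} : Set ℕ).indicator 1 ((∑ i, w.1 i) + w.2) *
        ((∏ i, (q.1 : Measure ℕ) {w.1 i}) * (q.2 : Measure ℕ) {w.2}) := by
  rw [← lintegral_stepLaw, lintegral_indicator_one (measurableSet_singleton j)]

lemma measurable_stepLaw (z j : ℕ) : Measurable fun q => stepLaw q z {j} := by
  simp_rw [stepLaw_singleton]
  refine Measurable.tsum fun w => Measurable.const_mul (Measurable.mul ?_ ?_) _
  · exact Finset.measurable_prod _ fun i _ => measurable_offspring _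
  · exact measurable_immigration _

/-- One prescribed family of offspring numbers and immigrants gives a lower bound. -/
lemma le_stepLaw (q : Env) {z : ℕ} (x : Fin z → ℕ) (y : ℕ) :
    (∏ i, (q.1 : Measure ℕ) {x i}) * (q.2 : Measure ℕ) {y} ≤ stepLaw q z {(∑ i, x i) + y} := by
  rw [stepLaw_singleton]
  refine le_trans ?_ (ENNReal.le_tsum (x, y))
  simp

/-- Forgetting the immigrants bounds the generating function of the one-step law. -/
lemma lintegral_pow_stepLaw_le (q : Env) (z : ℕ) {t : ℝ≥0∞} (ht : t ≤ 1) :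
    ∫⁻ j, t ^ j ∂(stepLaw q z) ≤ (∫⁻ j, t ^ j ∂(q.1 : Measure ℕ)) ^ z := by
  rw [stepLaw, lintegral_map (by fun_prop) (by fun_prop)]
  calc ∫⁻ p, t ^ ((∑ i, p.1 i) + p.2)
        ∂((Measure.pi fun _ : Fin z => (q.1 : Measure ℕ)).prod (q.2 : Measure ℕ))
      ≤ ∫⁻ p, ∏ i, t ^ (p.1 i)
        ∂((Measure.pi fun _ : Fin z => (q.1 : Measure ℕ)).prod (q.2 : Measure ℕ)) := by
        refine lintegral_mono fun p => ?_
        simp only [Finset.prod_pow_eq_pow_sum]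
        exact pow_le_pow_right_of_le_one' ht (Nat.le_add_right _ _)
    _ = ∫⁻ x, ∏ i, t ^ (x i) ∂(Measure.pi fun _ : Fin z => (q.1 : Measure ℕ)) := by
        rw [lintegral_prod _ (Measurable.of_discrete.aemeasurable)]
        simp
    _ = (∫⁻ j, t ^ j ∂(q.1 : Measure ℕ)) ^ z := by
        rw [lintegral_prod_eq_prod_lintegral_of_indepFun (μ := Measure.pi fun _ : Fin z =>
          (q.1 : Measure ℕ)) Finset.univ (fun i x => t ^ (x i))
          (iIndepFun_pi (X := fun _ j => t ^ j) fun i => by fun_prop) (fun i => by fun_prop)]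
        rw [Finset.prod_congr rfl (g := fun _ => ∫⁻ j, t ^ j ∂(q.1 : Measure ℕ))]
        · simp
        · intro i _
          exact (measurePreserving_eval (fun _ : Fin z => (q.1 : Measure ℕ)) i).lintegral_comp
            (f := fun j => t ^ j) (by fun_prop)

/-! ### The annealed Markov chain -/

/-- The annealed transition probability from `z` to `j`: the environment has been averaged out. -/
noncomputable def trans (μ : Measure Env) (z j : ℕ) : ℝ≥0∞ := ∫⁻ q, stepLaw q z {j} ∂μ

/-- The `n`-step annealed transition probabilities. Since the environments of different generations
are independent, these are the powers of the matrix `trans μ`. -/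
noncomputable def iter (μ : Measure Env) : ℕ → ℕ → ℕ → ℝ≥0∞
  | 0, k, j => if k = j then 1 else 0
  | n + 1, k, j => ∑' z, iter μ n k z * trans μ z j

lemma tsum_trans (μ : Measure Env) [IsProbabilityMeasure μ] (z : ℕ) : ∑' j, trans μ z j = 1 := by
  simp_rw [trans]
  rw [← lintegral_tsum fun j => (measurable_stepLaw z j).aemeasurable]
  have : ∀ q, ∑' j, stepLaw q z {j} = 1 := fun q => by
    have := lintegral_countable' (μ := stepLaw q z) (fun _ => 1)
    simpa using this.symm
  simp [this]

lemma tsum_iter (μ : Measure Env) [IsProbabilityMeasure μ] (n k : ℕ) : ∑' j, iter μ n k j = 1 := by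
  induction n with
  | zero => simp [iter]
  | succ n ih =>
    simp_rw [iter]
    rw [ENNReal.tsum_comm]
    simp_rw [ENNReal.tsum_mul_left, tsum_trans, mul_one, ih]

lemma iter_le_one (μ : Measure Env) [IsProbabilityMeasure μ] (n k j : ℕ) : iter μ n k j ≤ 1 :=
  (ENNReal.le_tsum j).trans (tsum_iter μ n k).le

lemma iter_ne_top (μ : Measure Env) [IsProbabilityMeasure μ] (n k j : ℕ) : iter μ n k j ≠ ∞ :=
  ((iter_le_one μ n k j).trans_lt ENNReal.one_lt_top).ne

lemma iter_one (μ : Measure Env) (k j : ℕ) : iter μ 1 k j = trans μ k j := by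
  simp [iter]

/-- The Chapman–Kolmogorov equation. -/
lemma iter_add (μ : Measure Env) (m n k j : ℕ) :
    iter μ (m + n) k j = ∑' z, iter μ m k z * iter μ n z j := by
  induction n generalizing j with
  | zero => simp [iter]
  | succ n ih =>
    rw [← add_assoc]
    simp_rw [iter, ih, ← ENNReal.tsum_mul_left, ← ENNReal.tsum_mul_right]
    rw [ENNReal.tsum_comm]
    simp_rw [mul_assoc]

lemma iter_mul_le (μ : Measure Env) (m n k z j : ℕ) :
    iter μ m k z * iter μ n z j ≤ iter μ (m + n) k j :=
  (ENNReal.le_tsum z).trans (iter_add μ m n k j).ge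

/-! ### The law of the process -/

section Law

variable {Ω : Type*}

/-- The quenched `n`-step transition probability from `k` to `j`, as a function of the
environment. -/
noncomputable def quenched (Q : ℕ → Ω → Env) (k : ℕ) : ℕ → ℕ → Ω → ℝ≥0∞
  | 0, j, _ => if k = j then 1 else 0
  | n + 1, j, ω => ∑' z, quenched Q k n z ω * stepLaw (Q n ω) z {j}

lemma measurable_quenched (Q : ℕ → Ω → Env) (k n j : ℕ) :
    Measurable[⨆ i ∈ Set.Iio n, MeasurableSpace.comap (Q i) inferInstance] (quenched Q k n j) := by
  induction n generalizing j with
  | zero => exact measurable_const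
  | succ n ih =>
    refine @Measurable.tsum Ω ℝ≥0∞ ℕ
      (⨆ i ∈ Set.Iio (n + 1), MeasurableSpace.comap (Q i) inferInstance) _ _ _ _ _ _ _ _ _ _ _ _
      fun z => Measurable.mul ?_ ?_
    · exact (ih z).mono (biSup_mono fun i hi => lt_trans hi (Nat.lt_succ_self n)) le_rfl
    · exact (measurable_stepLaw z j).comp ((comap_measurable (Q n)).mono
        (le_biSup (fun i => MeasurableSpace.comap (Q i) inferInstance)
          (Set.mem_Iio.2 (Nat.lt_succ_self n))) le_rfl)

lemma lintegral_quenched [mΩ : MeasurableSpace Ω] {P : Measure Ω} {μ : Measure Env} {k : ℕ}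
    [IsProbabilityMeasure P] {Q : ℕ → Ω → Env} {Z : ℕ → Ω → ℕ} (h : IsBPIRE P μ k Q Z) (n j : ℕ) :
    ∫⁻ ω, quenched Q k n j ω ∂P = iter μ n k j := by
  have hle : ∀ i, MeasurableSpace.comap (Q i) inferInstance ≤ mΩ := fun i =>
    (h.measurable_env i).comap_le
  induction n generalizing j with
  | zero => simp [quenched, iter]
  | succ n ih =>
    simp_rw [quenched, iter]
    rw [lintegral_tsum]
    · refine tsum_congr fun z => ?_
      have hind : Indep (⨆ i ∈ Set.Iio n, MeasurableSpace.comap (Q i) inferInstance)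
          (⨆ i ∈ ({n} : Set ℕ), MeasurableSpace.comap (Q i) inferInstance) P :=
        indep_iSup_of_disjoint hle h.indep_env (by simp)
      have hs : Measurable[⨆ i ∈ ({n} : Set ℕ), MeasurableSpace.comap (Q i) inferInstance]
          fun ω => stepLaw (Q n ω) z {j} :=
        (measurable_stepLaw z j).comp ((comap_measurable (Q n)).mono
          (le_biSup (fun i => MeasurableSpace.comap (Q i) inferInstance)
            (Set.mem_singleton n)) le_rfl)
      rw [lintegral_mul_eq_lintegral_mul_lintegral_of_independent_measurableSpace
        (iSup₂_le fun i _ => hle i) (iSup₂_le fun i _ => hle i) hind (measurable_quenched Q k n z)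
        hs, ih, trans, ← h.law_env n, lintegral_map (measurable_stepLaw z j) (h.measurable_env n)]
    · intro z
      exact (((measurable_quenched Q k n z).mono (iSup₂_le fun i _ => hle i) le_rfl).mul
        ((measurable_stepLaw z j).comp (h.measurable_env n))).aemeasurable

/-- If `A` has conditional probability `w` given `m`, then functions measurable with respect to `m`
may be integrated over `A` by means of the density `w`. -/
lemma setLIntegral_eq_of_density {m mΩ : MeasurableSpace Ω} (hm : m ≤ mΩ)
    {P : Measure Ω} [IsFiniteMeasure P]
    {A : Set Ω} {w : Ω → ℝ≥0∞} (hw : Measurable w)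
    (h : ∀ S, MeasurableSet[m] S → P (S ∩ A) = ∫⁻ ω in S, w ω ∂P)
    {φ : Ω → ℝ≥0∞} (hφ : Measurable[m] φ) :
    ∫⁻ ω in A, φ ω ∂P = ∫⁻ ω, w ω * φ ω ∂P := by
  have : (P.restrict A).trim hm = (P.withDensity w).trim hm := by
    refine @Measure.ext _ m _ _ fun S hS => ?_
    rw [trim_measurableSet_eq hm hS, trim_measurableSet_eq hm hS,
      Measure.restrict_apply (hm _ hS), withDensity_apply _ (hm _ hS), h S hS]
  rw [← lintegral_trim hm hφ, this, lintegral_trim hm hφ,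
    lintegral_withDensity_eq_lintegral_mul _ hw (hφ.mono hm le_rfl)]
  rfl

/-- Given the environment, `Z n` has the quenched law. -/
lemma measure_inter_eq_lintegral_quenched [mΩ : MeasurableSpace Ω]
    {P : Measure Ω} {μ : Measure Env} {k : ℕ}
    [IsProbabilityMeasure P] {Q : ℕ → Ω → Env} {Z : ℕ → Ω → ℕ} (h : IsBPIRE P μ k Q Z) (n j : ℕ)
    {S : Set Ω} (hS : MeasurableSet[⨆ i, MeasurableSpace.comap (Q i) inferInstance] S) :
    P (S ∩ Z n ⁻¹' {j}) = ∫⁻ ω in S, quenched Q k n j ω ∂P := by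
  have hQ : (⨆ i, MeasurableSpace.comap (Q i) inferInstance) ≤ mΩ :=
    iSup_le fun i => (h.measurable_env i).comap_le
  have hw : ∀ n j, Measurable (quenched Q k n j) := fun n j =>
    (measurable_quenched Q k n j).mono (iSup₂_le fun i _ => (h.measurable_env i).comap_le) le_rfl
  induction n generalizing j S with
  | zero =>
    simp only [quenched]
    by_cases hkj : k = j
    · simp only [hkj, if_true, setLIntegral_one]
      refine measure_congr ?_
      filter_upwards [h.init] with ω hω
      refine propext ⟨fun hs => hs.1, fun hs => ⟨hs, ?_⟩⟩
      simpa [hkj] using hω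
    · simp only [hkj, if_false, lintegral_zero]
      refine measure_mono_null Set.inter_subset_right ?_
      have : ∀ᵐ ω ∂P, ¬ (Z 0 ω = j) := by
        filter_upwards [h.init] with ω hω
        rw [hω]; exact hkj
      exact (measure_eq_zero_iff_ae_notMem (s := Z 0 ⁻¹' {j})).2 this
  | succ n ih =>
    have hpast : past Q Z n ≤ mΩ := sup_le hQ (iSup_le fun i => (h.measurable_process i).comap_le)
    -- conditioning on the past, over the part of `S` where `Z n = z`
    have step : ∀ z, P ((S ∩ Z (n + 1) ⁻¹' {j}) ∩ Z n ⁻¹' {z}) =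
        ∫⁻ ω in S, quenched Q k n z ω * stepLaw (Q n ω) z {j} ∂P := by
      intro z
      have hz : MeasurableSet[past Q Z n] (Z n ⁻¹' {z}) :=
        (le_sup_right (a := ⨆ i, MeasurableSpace.comap (Q i) inferInstance))  _
          (le_iSup (fun i : Fin (n + 1) => MeasurableSpace.comap (Z i) inferInstance) (Fin.last n)
            _ ⟨{z}, measurableSet_singleton z, rfl⟩)
      have hT : MeasurableSet[past Q Z n] (S ∩ Z n ⁻¹' {z}) :=
        (((le_sup_left (a := ⨆ i, MeasurableSpace.comap (Q i) inferInstance)) _ hS).inter hz)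
      have hj : MeasurableSet (Z (n + 1) ⁻¹' {j}) :=
        h.measurable_process _ (measurableSet_singleton j)
      have hmeas : Measurable fun ω => stepLaw (Q n ω) z {j} :=
        (measurable_stepLaw z j).comp (h.measurable_env n)
      have h1 := setIntegral_condExp hpast (μ := P)
        (f := (Z (n + 1) ⁻¹' {j}).indicator fun _ => (1 : ℝ))
        ((integrable_const _).indicator hj) hT
      rw [setIntegral_congr_ae (g := fun ω => (stepLaw (Q n ω) z).real {j}) (hpast _ hT)
        (by
          filter_upwards [h.markov n j] with ω hω hωT
          rw [hω, show Z n ω = z from hωT.2])] at h1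
      have h2 : P ((S ∩ Z n ⁻¹' {z}) ∩ Z (n + 1) ⁻¹' {j}) =
          ∫⁻ ω in S ∩ Z n ⁻¹' {z}, stepLaw (Q n ω) z {j} ∂P := by
        rw [setIntegral_indicator hj] at h1
        simp only [integral_const, MeasurableSet.univ, measureReal_restrict_apply,
          Set.univ_inter, smul_eq_mul, mul_one] at h1
        have h3 : ∫⁻ ω in S ∩ Z n ⁻¹' {z}, stepLaw (Q n ω) z {j} ∂P ≠ ∞ := by
          refine ((lintegral_mono fun ω => prob_le_one).trans_lt ?_).ne
          simp
        rw [← ENNReal.toReal_eq_toReal_iff' (measure_ne_top _ _) h3]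
        refine h1.symm.trans ?_
        exact integral_toReal hmeas.aemeasurable (ae_of_all _ fun ω => measure_lt_top _ _)
      have hφ : Measurable[⨆ i, MeasurableSpace.comap (Q i) inferInstance]
          (S.indicator fun ω => stepLaw (Q n ω) z {j}) :=
        Measurable.indicator ((measurable_stepLaw z j).comp ((comap_measurable (Q n)).mono
          (le_iSup (fun i => MeasurableSpace.comap (Q i) inferInstance) n) le_rfl)) hS
      have h4 := setLIntegral_eq_of_density hQ (P := P) (A := Z n ⁻¹' {z}) (hw n z)
        (fun T hT => ih z hT) hφ
      rw [setLIntegral_indicator (hQ _ hS), ← h2] at h4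
      rw [Set.inter_right_comm, h4, ← lintegral_indicator (hQ _ hS)]
      refine lintegral_congr fun ω => ?_
      by_cases hω : ω ∈ S <;> simp [hω]
    simp_rw [quenched]
    have hprod : ∀ z, AEMeasurable (fun ω => quenched Q k n z ω * stepLaw (Q n ω) z {j})
        (P.restrict S) := fun z =>
      ((hw n z).mul ((measurable_stepLaw z j).comp (h.measurable_env n))).aemeasurable
    rw [lintegral_tsum hprod]
    simp_rw [← step]
    rw [← measure_iUnion]
    · congr 1
      ext ω
      simp
    · intro a b hab
      refine Set.disjoint_left.2 fun ω ha hb => hab ?_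
      exact (show Z n ω = a from ha.2).symm.trans hb.2
    · intro z
      exact ((hQ _ hS).inter (h.measurable_process _ (measurableSet_singleton j))).inter
        (h.measurable_process _ (measurableSet_singleton z))

/-- The annealed law of `Z n` is given by the matrix powers `iter`. -/
lemma measure_process_eq [mΩ : MeasurableSpace Ω] {P : Measure Ω} {μ : Measure Env} {k : ℕ}
    [IsProbabilityMeasure P] {Q : ℕ → Ω → Env} {Z : ℕ → Ω → ℕ} (h : IsBPIRE P μ k Q Z) (n j : ℕ) :
    P {ω | Z n ω = j} = iter μ n k j := by
  have := measure_inter_eq_lintegral_quenched h n j (S := Set.univ) MeasurableSet.univ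
  rw [Set.univ_inter, Measure.restrict_univ, lintegral_quenched h] at this
  exact this

end Law

/-! ### Lower bounds and communication of states -/

lemma trans_ne_zero {μ : Measure Env} {S : Set Env} (hS : μ S ≠ 0) {z j : ℕ}
    (h : ∀ q ∈ S, stepLaw q z {j} ≠ 0) : trans μ z j ≠ 0 := by
  intro h0
  rw [trans, lintegral_eq_zero_iff (measurable_stepLaw z j)] at h0
  exact hS (measure_mono_null h h0)

/-- Under assumption (A), the chain jumps from `z` to any `j ≤ z` with a probability that decays at
most geometrically in `z`: `j` individuals have one child, the others none, and nobody
immigrates. -/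
lemma exists_le_trans {μ : Measure Env} [IsProbabilityMeasure μ]
    (hA : 0 < μ {q | 0 < (q.2 : Measure ℕ) {0} ∧ 0 < (q.1 : Measure ℕ) {0} ∧
      0 < (q.1 : Measure ℕ) {1}}) :
    ∃ c ε : ℝ, 0 < c ∧ 0 < ε ∧ ε ≤ 1 ∧
      ∀ z j, j ≤ z → ENNReal.ofReal (ε ^ (z + 1) * c) ≤ trans μ z j := by
  set S : ℕ → Set Env := fun n => {q | (n + 1 : ℝ≥0∞)⁻¹ ≤ (q.2 : Measure ℕ) {0} ∧
    (n + 1 : ℝ≥0∞)⁻¹ ≤ (q.1 : Measure ℕ) {0} ∧ (n + 1 : ℝ≥0∞)⁻¹ ≤ (q.1 : Measure ℕ) {1}} with hS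
  have hSm : ∀ n, MeasurableSet (S n) := fun n =>
    (measurableSet_le measurable_const (measurable_immigration 0)).inter
      ((measurableSet_le measurable_const (measurable_offspring 0)).inter
        (measurableSet_le measurable_const (measurable_offspring 1)))
  obtain ⟨n, hn⟩ : ∃ n, μ (S n) ≠ 0 := by
    by_contra! hcon
    refine hA.ne' (measure_mono_null ?_ (measure_iUnion_null hcon))
    rintro q ⟨h1, h2, h3⟩
    have hpos : (0 : ℝ≥0∞) < min ((q.2 : Measure ℕ) {0})
        (min ((q.1 : Measure ℕ) {0}) ((q.1 : Measure ℕ) {1})) := lt_min h1 (lt_min h2 h3)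
    obtain ⟨n, hn⟩ := ENNReal.exists_inv_nat_lt hpos.ne'
    have hle : (n + 1 : ℝ≥0∞)⁻¹ ≤ (n : ℝ≥0∞)⁻¹ := ENNReal.inv_le_inv.2 le_self_add
    have := hle.trans hn.le
    simp only [le_min_iff] at this
    exact Set.mem_iUnion.2 ⟨n, this⟩
  refine ⟨μ.real (S n), (n + 1 : ℝ)⁻¹, ENNReal.toReal_pos hn (measure_ne_top _ _),
    by positivity, inv_le_one_of_one_le₀ (by simp), fun z j hj => ?_⟩
  have hε : ENNReal.ofReal (n + 1 : ℝ)⁻¹ = (n + 1 : ℝ≥0∞)⁻¹ := by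
    rw [ENNReal.ofReal_inv_of_pos (by positivity), ENNReal.ofReal_add (by positivity) zero_le_one]
    simp
  rw [ENNReal.ofReal_mul (by positivity), ENNReal.ofReal_pow (by positivity), hε,
    ofReal_measureReal, ← setLIntegral_const]
  refine (setLIntegral_mono' (hSm n) fun q hq => ?_).trans (setLIntegral_le_lintegral _ _)
  have hsum : (∑ i : Fin z, if (i : ℕ) < j then 1 else 0) + 0 = j := by
    rw [Finset.sum_boole, add_zero, Fin.card_filter_val_lt, Nat.cast_id, min_eq_right hj]
  have h := le_stepLaw q (fun i : Fin z => if (i : ℕ) < j then 1 else 0) 0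
  rw [hsum] at h
  refine le_trans ?_ h
  rw [pow_succ]
  refine mul_le_mul' ?_ hq.1
  calc ((n + 1 : ℝ≥0∞)⁻¹) ^ z = ∏ _i : Fin z, (n + 1 : ℝ≥0∞)⁻¹ := by simp
    _ ≤ _ := Finset.prod_le_prod' fun i _ => by
      split_ifs
      exacts [hq.2.2, hq.2.1]

lemma exists_singleton_ne_zero (ν : Measure ℕ) {S : Set ℕ} (h : ν S ≠ 0) :
    ∃ b ∈ S, ν {b} ≠ 0 := by
  by_contra! hcon
  exact h ((measure_null_iff_singleton S.to_countable).2 hcon)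

/-- A supercritical environment lets every population at least double in one generation. -/
lemma exists_trans_growth {μ : Measure Env} [IsProbabilityMeasure μ]
    (hsuper : 0 < ∫ q, Real.log (offspringMean q).toReal ∂μ) :
    ∃ a b : ℕ, 2 ≤ a ∧ ∀ z, trans μ z (a * z + b) ≠ 0 := by
  have h1 : μ {q | 1 < offspringMean q} ≠ 0 := by
    intro h0
    have hae : ∀ᵐ q ∂μ, offspringMean q ≤ 1 := by
      filter_upwards [measure_eq_zero_iff_ae_notMem.1 h0] with q hq
      exact not_lt.1 hq
    refine hsuper.not_ge (integral_nonpos_of_ae ?_)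
    filter_upwards [hae] with q hq
    refine Real.log_nonpos ENNReal.toReal_nonneg ?_
    exact ENNReal.toReal_le_of_le_ofReal zero_le_one (by simpa using hq)
  obtain ⟨⟨a, b⟩, hab⟩ : ∃ w : ℕ × ℕ, μ {q | 2 ≤ w.1 ∧ (q.1 : Measure ℕ) {w.1} ≠ 0 ∧
      (q.2 : Measure ℕ) {w.2} ≠ 0} ≠ 0 := by
    by_contra! hcon
    refine h1 (measure_mono_null ?_ (measure_iUnion_null hcon))
    intro q hq
    obtain ⟨b, -, hb⟩ := exists_singleton_ne_zero (q.2 : Measure ℕ) (S := Set.univ) (by simp)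
    obtain ⟨a, ha, ha'⟩ : ∃ a, 2 ≤ a ∧ (q.1 : Measure ℕ) {a} ≠ 0 := by
      by_contra! hcon
      refine (show 1 < offspringMean q from hq).not_ge ?_
      rw [offspringMean, tsum_eq_single 1]
      · simpa using prob_le_one
      · intro j hj
        rcases Nat.lt_or_ge j 2 with h2 | h2
        · have : j = 0 := by omega
          simp [this]
        · simp [hcon j h2]
    exact Set.mem_iUnion.2 ⟨(a, b), ha, ha', hb⟩
  refine ⟨a, b, ?_, fun z => trans_ne_zero hab fun q hq => ?_⟩
  · by_contra h2
    simp [h2] at hab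
  · have h := le_stepLaw q (fun _ : Fin z => a) b
    simp only [Finset.sum_const, Finset.card_univ, Fintype.card_fin, smul_eq_mul,
      Finset.prod_const] at h
    rw [mul_comm z a] at h
    exact fun h0 => mul_ne_zero (pow_ne_zero _ hq.2.1) hq.2.2 (le_zero_iff.1 (h0 ▸ h))

lemma exists_trans_immigration {μ : Measure Env}
    (himm : 0 < μ {q | (q.2 : Measure ℕ) {0} < 1}) : ∃ b, 1 ≤ b ∧ trans μ 0 b ≠ 0 := by
  obtain ⟨b, hb⟩ : ∃ b, μ {q | 1 ≤ b ∧ (q.2 : Measure ℕ) {b} ≠ 0} ≠ 0 := by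
    by_contra! hcon
    refine himm.ne' (measure_mono_null ?_ (measure_iUnion_null hcon))
    intro q hq
    have h0 : (q.2 : Measure ℕ) {0}ᶜ ≠ 0 := by
      rw [Ne, prob_compl_eq_zero_iff (measurableSet_singleton 0)]
      exact ne_of_lt hq
    obtain ⟨b, hb, hb'⟩ := exists_singleton_ne_zero _ h0
    exact Set.mem_iUnion.2 ⟨b, Nat.one_le_iff_ne_zero.2 hb, hb'⟩
  refine ⟨b, ?_, trans_ne_zero hb fun q hq => ?_⟩
  · by_contra h2
    simp [h2] at hb
  · have h := le_stepLaw q (fun _ : Fin 0 => 0) b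
    simp only [Finset.univ_eq_empty, Finset.prod_empty, one_mul, Finset.sum_empty, zero_add] at h
    exact fun h0 => hq.2 (le_zero_iff.1 (h0 ▸ h))

lemma iter_add_ne_zero {μ : Measure Env} {m n k z j : ℕ} (h1 : iter μ m k z ≠ 0)
    (h2 : iter μ n z j ≠ 0) : iter μ (m + n) k j ≠ 0 := fun h0 =>
  mul_ne_zero h1 h2 (le_zero_iff.1 (h0 ▸ iter_mul_le μ m n k z j))

/-- All states, including `0`, communicate. -/
lemma exists_iter_ne_zero {μ : Measure Env} [IsProbabilityMeasure μ]
    (hsuper : 0 < ∫ q, Real.log (offspringMean q).toReal ∂μ)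
    (himm : 0 < μ {q | (q.2 : Measure ℕ) {0} < 1})
    (hA : 0 < μ {q | 0 < (q.2 : Measure ℕ) {0} ∧ 0 < (q.1 : Measure ℕ) {0} ∧
      0 < (q.1 : Measure ℕ) {1}}) (k j : ℕ) : ∃ n, iter μ n k j ≠ 0 := by
  obtain ⟨a, b, ha, hab⟩ := exists_trans_growth hsuper
  obtain ⟨b', hb', hb0⟩ := exists_trans_immigration himm
  obtain ⟨c, ε, hc, hε, -, hcε⟩ := exists_le_trans hA
  have hgrow : ∀ N, ∃ n z, N ≤ z ∧ iter μ n k z ≠ 0 := by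
    intro N
    induction N with
    | zero => exact ⟨0, k, Nat.zero_le _, by simp [iter]⟩
    | succ N ih =>
      obtain ⟨n, z, hz, hn⟩ := ih
      rcases Nat.eq_zero_or_pos z with rfl | hz0
      · exact ⟨n + 1, b', by omega, iter_add_ne_zero hn (by rwa [iter_one])⟩
      · exact ⟨n + 1, a * z + b, by nlinarith, iter_add_ne_zero hn (by rw [iter_one]; exact hab z)⟩
  obtain ⟨n, z, hz, hn⟩ := hgrow j
  refine ⟨n + 1, iter_add_ne_zero hn ?_⟩
  rw [iter_one]
  exact ((ENNReal.ofReal_pos.2 (by positivity)).trans_le (hcε z j hz)).ne'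

/-! ### Geometric decay from a Lyapunov function -/

/-- Suppose `V` is a nonincreasing function that the chain contracts by the factor `γ < 1` above the
level `z₀`. Then the return probabilities decay geometrically. The function `z ↦ V (max z z₀)` is
superharmonic, and since the chain leads from every state below `z₀` to a state where this function
is strictly smaller, a power of the transition matrix contracts it everywhere. -/
lemma exists_iter_le_pow {μ : Measure Env} [IsProbabilityMeasure μ]
    (hcomm : ∀ k j, ∃ n, iter μ n k j ≠ 0) {V : ℕ → ℝ≥0∞} (hanti : Antitone V)
    (h0 : ∀ z, V z ≠ 0) (hfin : ∀ z, V z ≠ ∞) {z₀ N : ℕ} (hN : V N < V z₀) {γ : ℝ≥0∞} (hγ : γ < 1)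
    (hV : ∀ z, z₀ ≤ z → ∑' j, trans μ z j * V j ≤ γ * V z) :
    ∃ m γ', 0 < m ∧ γ' < 1 ∧ ∀ n, iter μ (n * m) 1 1 ≤ γ' ^ n := by
  set W : ℕ → ℝ≥0∞ := fun z => V (max z z₀) with hW
  have hW0 : ∀ z, W z ≤ V z₀ := fun z => hanti (le_max_right _ _)
  have hWV : ∀ z, W z ≤ V z := fun z => hanti (le_max_left _ _)
  have hWz : ∀ z, z ≤ z₀ → W z = V z₀ := fun z hz => by simp [hW, hz]
  have hWne : ∀ z, W z ≠ 0 := fun z => h0 _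
  have hWfin : ∀ z, W z ≠ ∞ := fun z => hfin _
  set U : ℕ → ℕ → ℝ≥0∞ := fun n z => ∑' j, iter μ n z j * W j with hU
  have hUadd : ∀ m n z, U (m + n) z = ∑' y, iter μ m z y * U n y := by
    intro m n z
    simp_rw [hU, iter_add, ← ENNReal.tsum_mul_left, ← ENNReal.tsum_mul_right]
    rw [ENNReal.tsum_comm]
    simp_rw [mul_assoc]
  have hU1 : ∀ z, z₀ ≤ z → U 1 z ≤ γ * W z := by
    intro z hz
    have : W z = V z := by simp [hW, hz]
    rw [this]
    refine le_trans (ENNReal.tsum_le_tsum fun j => ?_) (hV z hz)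
    rw [iter_one]
    exact mul_le_mul' le_rfl (hWV j)
  have hsup : ∀ z, U 1 z ≤ W z := by
    intro z
    rcases le_total z₀ z with hz | hz
    · exact (hU1 z hz).trans (mul_le_of_le_one_left' hγ.le)
    · rw [hWz z hz]
      calc U 1 z ≤ ∑' j, iter μ 1 z j * V z₀ :=
            ENNReal.tsum_le_tsum fun j => mul_le_mul' le_rfl (hW0 j)
        _ = V z₀ := by rw [ENNReal.tsum_mul_right, tsum_iter, one_mul]
  have hUanti : ∀ z, Antitone fun n => U n z := by
    intro z
    refine antitone_nat_of_succ_le fun n => ?_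
    rw [hUadd]
    exact ENNReal.tsum_le_tsum fun j => mul_le_mul' le_rfl (hsup j)
  -- below `z₀` the contraction becomes strict after finitely many steps
  have hstrict : ∀ z, ∃ n, z < z₀ → U n z < W z := by
    intro z
    obtain ⟨n, hn⟩ := hcomm z N
    refine ⟨n, fun hz => ?_⟩
    rw [hWz z hz.le]
    calc U n z < ∑' j, iter μ n z j * V z₀ := by
          refine ENNReal.tsum_lt_tsum (i := N) ?_ (fun j => mul_le_mul' le_rfl (hW0 j)) ?_
          · refine ((ENNReal.tsum_le_tsum fun j => mul_le_mul' le_rfl (hW0 j)).trans_lt ?_).ne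
            rw [ENNReal.tsum_mul_right, tsum_iter, one_mul]
            exact (hfin z₀).lt_top
          · exact ENNReal.mul_lt_mul_right hn (iter_ne_top μ n z N) ((hWV N).trans_lt hN)
      _ = V z₀ := by rw [ENNReal.tsum_mul_right, tsum_iter, one_mul]
  choose n hn using hstrict
  set m : ℕ := 1 + (Finset.range z₀).sup n with hm
  set γ' : ℝ≥0∞ := max γ ((Finset.range z₀).sup fun z => U m z / W z) with hγ'
  have hγ'1 : γ' < 1 := by
    refine max_lt hγ ((Finset.sup_lt_iff (by simp)).2 fun z hz => ?_)
    rw [ENNReal.div_lt_iff (Or.inl (hWne z)) (Or.inl (hWfin z)), one_mul]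
    refine lt_of_le_of_lt (hUanti z ?_) (hn z (Finset.mem_range.1 hz))
    exact (Finset.le_sup hz).trans (Nat.le_add_left _ _)
  have hcontr : ∀ z, U m z ≤ γ' * W z := by
    intro z
    rcases Nat.lt_or_ge z z₀ with hz | hz
    · rw [← ENNReal.div_le_iff (hWne z) (hWfin z)]
      exact le_max_of_le_right
        (Finset.le_sup (f := fun z => U m z / W z) (Finset.mem_range.2 hz))
    · exact ((hUanti z (Nat.le_add_right 1 _)).trans (hU1 z hz)).trans
        (mul_le_mul' (le_max_left _ _) le_rfl)
  have hpow : ∀ i z, U (i * m) z ≤ γ' ^ i * W z := by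
    intro i
    induction i with
    | zero => intro z; simp [hU, iter]
    | succ i ih =>
      intro z
      rw [add_mul, one_mul, hUadd]
      calc ∑' y, iter μ (i * m) z y * U m y ≤ ∑' y, iter μ (i * m) z y * (γ' * W y) :=
            ENNReal.tsum_le_tsum fun y => mul_le_mul' le_rfl (hcontr y)
        _ = γ' * U (i * m) z := by
            simp_rw [hU, ← ENNReal.tsum_mul_left]
            exact tsum_congr fun y => by ring
        _ ≤ γ' * (γ' ^ i * W z) := mul_le_mul' le_rfl (ih z)
        _ = _ := by ring
  refine ⟨m, γ', by omega, hγ'1, fun i => ?_⟩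
  have h1 := (ENNReal.le_tsum (f := fun j => iter μ (i * m) 1 j * W j) 1).trans (hpow i 1)
  exact (ENNReal.mul_le_mul_iff_left (hWne 1) (hWfin 1)).1 h1

/-! ### Generating functions near `1` -/

/-- The generating function of a law `ν` on `ℕ`. -/
noncomputable def genFun (ν : Measure ℕ) (t : ℝ) : ℝ≥0∞ := ∑' j, ENNReal.ofReal t ^ j * ν {j}

lemma lintegral_pow_eq_genFun (ν : Measure ℕ) (t : ℝ) :
    ∫⁻ j, ENNReal.ofReal t ^ j ∂ν = genFun ν t := lintegral_countable' _

lemma genFun_eq_ofReal (ν : Measure ℕ) [IsProbabilityMeasure ν] {t : ℝ} (ht : 0 ≤ t)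
    (ht1 : t ≤ 1) :
    Summable (fun j => t ^ j * ν.real {j}) ∧
      genFun ν t = ENNReal.ofReal (∑' j, t ^ j * ν.real {j}) := by
  have hs : Summable fun j => ν.real {j} := by
    refine ENNReal.summable_toReal ?_
    have h := lintegral_countable' (μ := ν) fun _ => 1
    simp only [lintegral_const, measure_univ, one_mul] at h
    exact h ▸ ENNReal.one_ne_top
  have hs' : Summable (fun j => t ^ j * ν.real {j}) :=
    hs.of_nonneg_of_le (fun j => by positivity) fun j =>
      mul_le_of_le_one_left measureReal_nonneg (pow_le_one₀ ht ht1)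
  refine ⟨hs', ?_⟩
  rw [ENNReal.ofReal_tsum_of_nonneg (fun j => by positivity) hs', genFun]
  refine tsum_congr fun j => ?_
  rw [ENNReal.ofReal_mul (by positivity), ENNReal.ofReal_pow ht, ofReal_measureReal]

lemma genFun_le_exp (ν : Measure ℕ) [IsProbabilityMeasure ν] {δ w : ℝ} (hδ : ν.real {0} ≤ δ)
    (hw : 0 ≤ w) (hw1 : w ≤ 1) :
    genFun ν (1 - w) ≤ ENNReal.ofReal (Real.exp (-((1 - δ) * w))) := by
  have h1 : genFun ν (1 - w) ≤ ν {0} + ENNReal.ofReal (1 - w) * ν {0}ᶜ := by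
    rw [← lintegral_pow_eq_genFun, ← lintegral_add_compl _ (measurableSet_singleton 0)]
    refine add_le_add ?_ ?_
    · rw [lintegral_singleton]; simp
    · rw [← setLIntegral_const]
      refine setLIntegral_mono' (measurableSet_singleton 0).compl fun j hj => ?_
      exact pow_le_of_le_one (by simp) (by simpa using hw) hj
  refine h1.trans ?_
  rw [← ofReal_measureReal, ← ofReal_measureReal, ← ENNReal.ofReal_mul (by linarith),
    ← ENNReal.ofReal_add measureReal_nonneg (mul_nonneg (by linarith) measureReal_nonneg)]
  refine ENNReal.ofReal_le_ofReal ?_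
  rw [probReal_compl_eq_one_sub (measurableSet_singleton 0)]
  refine le_trans ?_ (Real.add_one_le_exp _)
  nlinarith

lemma tendsto_mul_one_sub_pow (v : ℝ) (j : ℕ) :
    Tendsto (fun z : ℕ => (z : ℝ) * (1 - (1 - v / z) ^ j)) atTop (𝓝 (j * v)) := by
  have hv : Tendsto (fun z : ℕ => v / (z : ℝ)) atTop (𝓝 0) :=
    tendsto_const_nhds.div_atTop tendsto_natCast_atTop_atTop
  induction j with
  | zero => simp
  | succ j ih =>
    have h2 : Tendsto (fun z : ℕ => v * (1 - v / (z : ℝ)) ^ j) atTop (𝓝 (v * (1 - 0) ^ j)) :=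
      ((tendsto_const_nhds.sub hv).pow j).const_mul v
    have h3 := ih.add h2
    rw [sub_zero, one_pow, mul_one] at h3
    rw [show ((j + 1 : ℕ) : ℝ) * v = j * v + v by push_cast; ring]
    refine h3.congr' ?_
    filter_upwards [eventually_gt_atTop 0] with z hz
    have : (z : ℝ) ≠ 0 := by positivity
    have hzv : (z : ℝ) * (v / z) = v := by field_simp
    rw [pow_succ]
    linear_combination ((1 - v / z) ^ j) * (-hzv)

/-- The law of large numbers, in terms of generating functions: rescaled sums of `z` independent
variables with law `ν` concentrate at the mean. -/
lemma tendsto_genFun_pow (ν : Measure ℕ) [IsProbabilityMeasure ν]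
    (hm : ∑' j : ℕ, (j : ℝ≥0∞) * ν {j} ≠ ∞) {v : ℝ} (hv : 0 ≤ v) :
    Tendsto (fun z : ℕ => genFun ν (1 - v / z) ^ z) atTop
      (𝓝 (ENNReal.ofReal (Real.exp (-((∑' j : ℕ, (j : ℝ≥0∞) * ν {j}).toReal * v))))) := by
  have hms : Summable fun j : ℕ => (j : ℝ) * ν.real {j} := by
    have := ENNReal.summable_toReal hm
    simpa [Measure.real] using this
  have hmr : (∑' j : ℕ, (j : ℝ≥0∞) * ν {j}).toReal = ∑' j : ℕ, (j : ℝ) * ν.real {j} := by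
    rw [ENNReal.tsum_toReal_eq fun j => ENNReal.ne_top_of_tsum_ne_top hm j]
    simp [Measure.real]
  rw [hmr]
  set m := ∑' j : ℕ, (j : ℝ) * ν.real {j} with hmdef
  have hev : ∀ᶠ z : ℕ in atTop, 0 < (z : ℝ) ∧ v ≤ z := by
    filter_upwards [tendsto_natCast_atTop_atTop.eventually_gt_atTop (0 : ℝ),
      tendsto_natCast_atTop_atTop.eventually_ge_atTop v] with z h1 h2 using ⟨h1, h2⟩
  have hone : ∑' j, ν.real {j} = 1 := by
    have h := genFun_eq_ofReal ν zero_le_one le_rfl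
    have h1 : genFun ν 1 = 1 := by rw [← lintegral_pow_eq_genFun]; simp
    rw [h1] at h
    simpa using (ENNReal.ofReal_eq_one.1 h.2.symm)
  have key : Tendsto (fun z : ℕ => ∑' j, ((z : ℝ) * (1 - (1 - v / z) ^ j)) * ν.real {j}) atTop
      (𝓝 (∑' j : ℕ, (j * v) * ν.real {j})) := by
    refine tendsto_tsum_of_dominated_convergence (bound := fun j : ℕ => v * (j * ν.real {j}))
      (hms.mul_left v) (fun j => (tendsto_mul_one_sub_pow v j).mul_const _) ?_
    filter_upwards [hev] with z hz j
    have h0 : 0 ≤ v / z := by have := hz.1; positivity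
    have h1 : v / z ≤ 1 := (div_le_one hz.1).2 hz.2
    have h2 : (1 - v / z) ^ j ≤ 1 := pow_le_one₀ (by linarith) (by linarith)
    have h3 : 1 + (j : ℝ) * (-(v / z)) ≤ (1 + (-(v / z))) ^ j :=
      one_add_mul_le_pow (by linarith) j
    have h4 : (z : ℝ) * (v / z) = v := by have := hz.1; field_simp
    rw [← sub_eq_add_neg] at h3
    rw [Real.norm_of_nonneg (mul_nonneg (mul_nonneg hz.1.le (by linarith)) measureReal_nonneg),
      ← mul_assoc]
    refine mul_le_mul_of_nonneg_right ?_ measureReal_nonneg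
    calc (z : ℝ) * (1 - (1 - v / z) ^ j) ≤ z * (j * (v / z)) :=
          mul_le_mul_of_nonneg_left (by linarith) hz.1.le
      _ = j * (z * (v / z)) := by ring
      _ = v * j := by rw [h4, mul_comm]
  have hlim : ∑' j : ℕ, (j * v) * ν.real {j} = m * v := by
    rw [hmdef, ← tsum_mul_right]
    exact tsum_congr fun j => by ring
  rw [hlim] at key
  set g : ℕ → ℝ := fun z => (∑' j, (1 - v / z) ^ j * ν.real {j}) - 1 with hg
  have hzg : Tendsto (fun z : ℕ => (z : ℝ) * g z) atTop (𝓝 (-(m * v))) := by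
    refine key.neg.congr' ?_
    filter_upwards [hev] with z hz
    have h0 : 0 ≤ v / z := by have := hz.1; positivity
    have h1 : v / z ≤ 1 := (div_le_one hz.1).2 hz.2
    have hs := (genFun_eq_ofReal ν (t := 1 - v / z) (by linarith) (by linarith)).1
    have hs1 := (genFun_eq_ofReal ν zero_le_one le_rfl).1
    simp only [one_pow, one_mul] at hs1
    have hgz : g z = (∑' j, (1 - v / z) ^ j * ν.real {j}) - ∑' j, ν.real {j} := by rw [hone]
    rw [hgz, ← hs.tsum_sub hs1, ← tsum_mul_left, ← tsum_neg]
    exact tsum_congr fun j => by ring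
  have hexp := ENNReal.tendsto_ofReal (Real.tendsto_one_add_pow_exp_of_tendsto hzg)
  refine hexp.congr' ?_
  filter_upwards [hev] with z hz
  have h0 : 0 ≤ v / z := by have := hz.1; positivity
  have h1 : v / z ≤ 1 := (div_le_one hz.1).2 hz.2
  rw [(genFun_eq_ofReal ν (t := 1 - v / z) (by linarith) (by linarith)).2, ENNReal.ofReal_pow]
  · simp [hg]
  · rw [hg]
    simp only [add_sub_cancel]
    exact tsum_nonneg fun j => mul_nonneg (pow_nonneg (by linarith) _) measureReal_nonneg

/-! ### The Lyapunov function -/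

/-- The integral `∫ v in (0, z), ν̂(1 - v / z) ^ z * v ^ (s - 1)`, where `ν̂` is the generating
function of `ν`. It is `z ^ s` times the integral of `ν̂(1 - u) ^ z * u ^ (s - 1)` over `(0, 1)`. -/
noncomputable def scaledMoment (s : ℝ) (ν : Measure ℕ) (z : ℕ) : ℝ≥0∞ :=
  ∫⁻ v in Set.Ioo (0 : ℝ) z, genFun ν (1 - v / z) ^ z * ENNReal.ofReal (v ^ (s - 1))

lemma measurable_genFun (ν : Measure ℕ) : Measurable (genFun ν) :=
  Measurable.tsum fun j => by fun_prop

lemma measurable_genFun_uncurry :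
    Measurable fun p : Env × ℝ => genFun (p.1.1 : Measure ℕ) p.2 :=
  Measurable.tsum fun j =>
    (Measurable.pow_const (ENNReal.measurable_ofReal.comp measurable_snd) j).mul
      ((measurable_offspring j).comp measurable_fst)

lemma measurable_rpow_sub_one (s : ℝ) : Measurable fun v : ℝ => ENNReal.ofReal (v ^ (s - 1)) := by
  fun_prop

lemma lintegral_exp_mul_rpow {s r : ℝ} (hs : 0 < s) (hr : 0 < r) :
    ∫⁻ v in Set.Ioi (0 : ℝ), ENNReal.ofReal (Real.exp (-(r * v))) * ENNReal.ofReal (v ^ (s - 1)) =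
      ENNReal.ofReal (r ^ (-s) * Real.Gamma s) := by
  have h := Real.integral_rpow_mul_exp_neg_mul_Ioi hs hr
  have hpos : 0 < (1 / r) ^ s * Real.Gamma s :=
    mul_pos (Real.rpow_pos_of_pos (by positivity) _) (Real.Gamma_pos_of_pos hs)
  have hint : IntegrableOn (fun t : ℝ => t ^ (s - 1) * Real.exp (-(r * t))) (Set.Ioi 0) := by
    by_contra hcon
    rw [integral_undef hcon] at h
    exact hpos.ne h
  rw [Real.rpow_neg hr.le, ← Real.inv_rpow hr.le, ← one_div, ← h,
    ofReal_integral_eq_lintegral_ofReal hint]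
  · refine setLIntegral_congr_fun measurableSet_Ioi fun v _ => ?_
    rw [← ENNReal.ofReal_mul (Real.exp_pos _).le, mul_comm]
  · refine (ae_restrict_iff' measurableSet_Ioi).2 (ae_of_all _ fun t ht => ?_)
    exact mul_nonneg (Real.rpow_nonneg (le_of_lt ht) _) (Real.exp_pos _).le

lemma genFun_pow_le {ν : Measure ℕ} [IsProbabilityMeasure ν] {δ : ℝ}
    (hν : ν.real {0} ≤ δ) {z : ℕ} {v : ℝ} (hv : v ∈ Set.Ioo (0 : ℝ) z) :
    genFun ν (1 - v / z) ^ z ≤ ENNReal.ofReal (Real.exp (-((1 - δ) * v))) := by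
  have hz : (0 : ℝ) < z := hv.1.trans hv.2
  refine (pow_le_pow_left' (genFun_le_exp ν hν (w := v / z) (by have := hv.1; positivity)
    ((div_le_one hz).2 hv.2.le)) z).trans ?_
  rw [← ENNReal.ofReal_pow (Real.exp_pos _).le, ← Real.exp_nat_mul]
  refine ENNReal.ofReal_le_ofReal (Real.exp_le_exp.2 (le_of_eq ?_))
  field_simp

lemma scaledMoment_le {ν : Measure ℕ} [IsProbabilityMeasure ν] {s δ : ℝ} (hs : 0 < s) (hδ : δ < 1)
    (hν : ν.real {0} ≤ δ) (z : ℕ) :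
    scaledMoment s ν z ≤ ENNReal.ofReal ((1 - δ) ^ (-s) * Real.Gamma s) := by
  rw [← lintegral_exp_mul_rpow hs (sub_pos.2 hδ)]
  refine (setLIntegral_mono' measurableSet_Ioo fun v hv => ?_).trans
    (lintegral_mono_set Set.Ioo_subset_Ioi_self)
  exact mul_le_mul' (genFun_pow_le hν hv) le_rfl

lemma tendsto_scaledMoment {ν : Measure ℕ} [IsProbabilityMeasure ν] {s δ : ℝ} (hs : 0 < s)
    (hδ : δ < 1) (hν : ν.real {0} ≤ δ) (hm : ∑' j : ℕ, (j : ℝ≥0∞) * ν {j} ≠ ∞)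
    (hm0 : ∑' j : ℕ, (j : ℝ≥0∞) * ν {j} ≠ 0) :
    Tendsto (scaledMoment s ν) atTop
      (𝓝 (ENNReal.ofReal ((∑' j : ℕ, (j : ℝ≥0∞) * ν {j}).toReal ^ (-s) * Real.Gamma s))) := by
  rw [← lintegral_exp_mul_rpow hs (ENNReal.toReal_pos hm0 hm)]
  have heq : ∀ z, scaledMoment s ν z = ∫⁻ v in Set.Ioi (0 : ℝ), (Set.Ioo (0 : ℝ) z).indicator
      (fun v => genFun ν (1 - v / z) ^ z * ENNReal.ofReal (v ^ (s - 1))) v := by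
    intro z
    rw [setLIntegral_indicator measurableSet_Ioo,
      Set.inter_eq_left.2 Set.Ioo_subset_Ioi_self, scaledMoment]
  simp_rw [funext heq]
  have hbd := lintegral_exp_mul_rpow hs (sub_pos.2 hδ)
  refine tendsto_lintegral_of_dominated_convergence
    (fun v => ENNReal.ofReal (Real.exp (-((1 - δ) * v))) * ENNReal.ofReal (v ^ (s - 1)))
    (fun z => ?_) (fun z => ae_of_all _ fun v => ?_) (by rw [hbd]; exact ENNReal.ofReal_ne_top) ?_
  · refine Measurable.indicator ?_ measurableSet_Ioo
    exact (((measurable_genFun ν).comp (by fun_prop)).pow_const z).mul (measurable_rpow_sub_one s)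
  · by_cases hv : v ∈ Set.Ioo (0 : ℝ) z
    · simp only [hv, Set.indicator_of_mem]
      exact mul_le_mul' (genFun_pow_le hν hv) le_rfl
    · simp only [hv, not_false_eq_true, Set.indicator_of_notMem, zero_le]
  · refine (ae_restrict_iff' measurableSet_Ioi).2 (ae_of_all _ fun v hv => ?_)
    have h1 := ENNReal.Tendsto.mul_const (tendsto_genFun_pow ν hm (le_of_lt hv))
      (b := ENNReal.ofReal (v ^ (s - 1))) (Or.inr ENNReal.ofReal_ne_top)
    refine h1.congr' ?_
    filter_upwards [tendsto_natCast_atTop_atTop.eventually_gt_atTop v] with z hz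
    rw [Set.indicator_of_mem (show v ∈ Set.Ioo (0 : ℝ) z from ⟨hv, hz⟩)]

lemma lintegral_comp_mul_left_of_pos {f : ℝ → ℝ≥0∞} (hf : Measurable f) {c : ℝ} (hc : 0 < c) :
    ∫⁻ u, f u = ENNReal.ofReal c * ∫⁻ v, f (c * v) := by
  conv_lhs => rw [← Real.smul_map_volume_mul_left hc.ne', lintegral_smul_measure,
    lintegral_map hf (by fun_prop), smul_eq_mul, abs_of_pos hc]

lemma lintegral_Ioo_one_eq (s : ℝ) {G : ℝ → ℝ≥0∞} (hG : Measurable G) {z : ℕ} (hz : 0 < z) :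
    ∫⁻ u in Set.Ioo (0 : ℝ) 1, G u * ENNReal.ofReal (u ^ (s - 1)) =
      ENNReal.ofReal ((z : ℝ) ^ (-s)) *
        ∫⁻ v in Set.Ioo (0 : ℝ) z, G (v / z) * ENNReal.ofReal (v ^ (s - 1)) := by
  have hz' : (0 : ℝ) < z := by positivity
  rw [← lintegral_indicator measurableSet_Ioo, ← lintegral_indicator measurableSet_Ioo,
    lintegral_comp_mul_left_of_pos (Measurable.indicator
      (hG.fun_mul (measurable_rpow_sub_one s)) measurableSet_Ioo) (inv_pos.2 hz'),
    ← lintegral_const_mul' _ _ ENNReal.ofReal_ne_top,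
    ← lintegral_const_mul' _ _ ENNReal.ofReal_ne_top]
  refine lintegral_congr fun v => ?_
  have hmem : (z : ℝ)⁻¹ * v ∈ Set.Ioo (0 : ℝ) 1 ↔ v ∈ Set.Ioo (0 : ℝ) z := by
    rw [inv_mul_eq_div, Set.mem_Ioo, Set.mem_Ioo, div_lt_one hz', div_pos_iff_of_pos_right hz']
  by_cases hv : v ∈ Set.Ioo (0 : ℝ) z
  · rw [Set.indicator_of_mem hv, Set.indicator_of_mem (hmem.2 hv), inv_mul_eq_div, ← mul_assoc,
      ← mul_assoc, mul_comm _ (G _), mul_comm _ (G _), mul_assoc, mul_assoc]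
    congr 1
    rw [← ENNReal.ofReal_mul (by positivity), ← ENNReal.ofReal_mul (by positivity),
      Real.div_rpow hv.1.le hz'.le, Real.rpow_neg hz'.le, Real.rpow_sub_one hz'.ne']
    congr 1
    have := (Real.rpow_pos_of_pos hz' s).ne'
    field_simp
  · rw [Set.indicator_of_notMem hv, Set.indicator_of_notMem (fun h => hv (hmem.1 h)), mul_zero,
      mul_zero]

/-- The function `z ↦ ∫ u in (0, 1), (1 - u) ^ z * u ^ (s - 1)`, the Beta integral
`B (z + 1) s`, which is of order `z ^ (-s)` for large `z`. As a mixture of powers it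
interacts well with generating functions. -/
noncomputable def lyapunov (s : ℝ) (z : ℕ) : ℝ≥0∞ :=
  ∫⁻ u in Set.Ioo (0 : ℝ) 1, ENNReal.ofReal (1 - u) ^ z * ENNReal.ofReal (u ^ (s - 1))

lemma lyapunov_antitone (s : ℝ) : Antitone (lyapunov s) := by
  intro a b hab
  refine setLIntegral_mono' measurableSet_Ioo fun u hu => mul_le_mul' ?_ le_rfl
  exact pow_le_pow_right_of_le_one' (by simpa using hu.1.le) hab

lemma lyapunov_ne_top {s : ℝ} (hs : 0 < s) (z : ℕ) : lyapunov s z ≠ ∞ := by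
  refine ((lyapunov_antitone s (Nat.zero_le z)).trans_lt ?_).ne
  have h : IntegrableOn (fun u : ℝ => u ^ (s - 1)) (Set.Ioo 0 1) :=
    (intervalIntegral.integrableOn_Ioo_rpow_iff one_pos).2 (by linarith)
  simpa [lyapunov] using h.setLIntegral_lt_top

lemma lyapunov_ne_zero (s : ℝ) (z : ℕ) : lyapunov s z ≠ 0 := by
  intro h
  rw [lyapunov, lintegral_eq_zero_iff (by fun_prop), EventuallyEq,
    ae_restrict_iff' measurableSet_Ioo] at h
  have hvol : (volume (Set.Ioo (0 : ℝ) 1)) ≠ 0 := by simp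
  refine hvol (measure_mono_null (fun u hu => ?_) h)
  simp only [Set.mem_compl_iff, Set.mem_ofPred_eq, not_forall]
  refine ⟨hu, mul_ne_zero (pow_ne_zero _ ?_) ?_⟩
  · simpa using hu.2
  · simpa using Real.rpow_pos_of_pos hu.1 _

/-- The Lyapunov function is the case of deterministic offspring number one. -/
lemma lyapunov_eq (s : ℝ) {z : ℕ} (hz : 0 < z) :
    lyapunov s z = ENNReal.ofReal ((z : ℝ) ^ (-s)) * scaledMoment s (Measure.dirac 1) z := by
  have h : ∀ t, genFun (Measure.dirac 1) t = ENNReal.ofReal t := fun t => by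
    rw [← lintegral_pow_eq_genFun]; simp
  rw [lyapunov, scaledMoment]
  simp_rw [h]
  exact lintegral_Ioo_one_eq s (G := fun u => ENNReal.ofReal (1 - u) ^ z) (by fun_prop) hz

/-- One step of the chain, applied to the Lyapunov function. -/
lemma tsum_trans_mul_lyapunov_le (μ : Measure Env) [IsProbabilityMeasure μ] (s : ℝ) {z : ℕ}
    (hz : 0 < z) :
    ∑' j, trans μ z j * lyapunov s j ≤
      ENNReal.ofReal ((z : ℝ) ^ (-s)) * ∫⁻ q, scaledMoment s (q.1 : Measure ℕ) z ∂μ := by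
  have hstep : ∀ q : Env, ∑' j, stepLaw q z {j} * lyapunov s j ≤
      ENNReal.ofReal ((z : ℝ) ^ (-s)) * scaledMoment s (q.1 : Measure ℕ) z := by
    intro q
    rw [scaledMoment, ← lintegral_Ioo_one_eq s (G := fun u => genFun (q.1 : Measure ℕ) (1 - u) ^ z)
      (((measurable_genFun _).comp (by fun_prop)).pow_const z) hz]
    simp_rw [lyapunov]
    simp_rw [← lintegral_const_mul' _ _ (measure_ne_top (stepLaw q z) _)]
    rw [← lintegral_tsum fun j => by fun_prop]
    refine setLIntegral_mono' measurableSet_Ioo fun u hu => ?_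
    simp_rw [← mul_assoc]
    rw [ENNReal.tsum_mul_right]
    refine mul_le_mul' ?_ le_rfl
    rw [← lintegral_pow_eq_genFun]
    refine le_trans (le_of_eq ?_)
      (lintegral_pow_stepLaw_le q z (t := ENNReal.ofReal (1 - u)) (by simpa using hu.1.le))
    rw [lintegral_countable']
    exact tsum_congr fun j => mul_comm _ _
  calc ∑' j, trans μ z j * lyapunov s j
      = ∫⁻ q, ∑' j, stepLaw q z {j} * lyapunov s j ∂μ := by
        rw [lintegral_tsum fun j => ((measurable_stepLaw z j).mul_const _).aemeasurable]
        exact tsum_congr fun j => (lintegral_mul_const _ (measurable_stepLaw z j)).symm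
    _ ≤ _ := by
        rw [← lintegral_const_mul' _ _ ENNReal.ofReal_ne_top]
        exact lintegral_mono hstep

lemma measurable_scaledMoment (s : ℝ) (z : ℕ) :
    Measurable fun q : Env => scaledMoment s (q.1 : Measure ℕ) z := by
  refine Measurable.lintegral_prod_right' (f := fun p : Env × ℝ =>
    genFun (p.1.1 : Measure ℕ) (1 - p.2 / z) ^ z * ENNReal.ofReal (p.2 ^ (s - 1))) ?_
  refine Measurable.mul (Measurable.pow_const ?_ z) ((measurable_rpow_sub_one s).comp measurable_snd)
  exact measurable_genFun_uncurry.comp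
    (measurable_fst.prodMk (measurable_const.sub (measurable_snd.div_const _)))

/-- If `E 𝔪(f) ^ (-s) < 1`, the chain contracts the Lyapunov function above some level. -/
lemma exists_lyapunov_contraction {μ : Measure Env} [IsProbabilityMeasure μ]
    (hmean : ∀ᵐ q ∂μ, 0 < offspringMean q ∧ offspringMean q < ∞) {δ : ℝ} (hδ : δ < 1)
    (hB : ∀ᵐ q ∂μ, (q.1 : Measure ℕ).real {0} < δ) {s : ℝ} (hs : 0 < s)
    (hlt : ∫⁻ q, ENNReal.ofReal ((offspringMean q).toReal ^ (-s)) ∂μ < 1) :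
    ∃ γ < 1, ∃ z₀ : ℕ, ∀ z, z₀ ≤ z → ∑' j, trans μ z j * lyapunov s j ≤ γ * lyapunov s z := by
  set Γ := ENNReal.ofReal (Real.Gamma s) with hΓ
  have hΓ0 : Γ ≠ 0 := by simpa [hΓ] using Real.Gamma_pos_of_pos hs
  set r := ∫⁻ q, ENNReal.ofReal ((offspringMean q).toReal ^ (-s)) ∂μ with hr
  -- numerator and denominator of the contraction ratio, both rescaled by `z ^ s`
  have hnum : Tendsto (fun z => ∫⁻ q, scaledMoment s (q.1 : Measure ℕ) z ∂μ) atTop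
      (𝓝 (r * Γ)) := by
    rw [hr, ← lintegral_mul_const _ (by
      exact (measurable_offspringMean.ennreal_toReal.pow_const _).ennreal_ofReal)]
    refine tendsto_lintegral_of_dominated_convergence
      (fun _ => ENNReal.ofReal ((1 - δ) ^ (-s) * Real.Gamma s))
      (measurable_scaledMoment s) (fun z => ?_) (by simp) ?_
    · filter_upwards [hB] with q hq using scaledMoment_le hs hδ hq.le z
    · filter_upwards [hB, hmean] with q hq hm
      rw [← ENNReal.ofReal_mul (Real.rpow_nonneg ENNReal.toReal_nonneg _)]
      exact tendsto_scaledMoment hs hδ hq.le hm.2.ne hm.1.ne'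
  have hden : Tendsto (scaledMoment s (Measure.dirac 1)) atTop (𝓝 Γ) := by
    have hone : ∑' j : ℕ, (j : ℝ≥0∞) * (Measure.dirac 1 : Measure ℕ) {j} = 1 := by
      rw [← lintegral_countable' (μ := Measure.dirac 1) fun j : ℕ => (j : ℝ≥0∞)]
      simp
    have h := tendsto_scaledMoment (ν := Measure.dirac 1) hs (δ := 0) one_pos
      (by simp [Measure.real]) (by rw [hone]; simp) (by rw [hone]; simp)
    rw [hone] at h
    simpa using h
  obtain ⟨γ, hrγ, hγ⟩ := exists_between hlt
  have hγ0 : γ ≠ ∞ := (hγ.trans ENNReal.one_lt_top).ne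
  have hev : ∀ᶠ z in atTop, ∫⁻ q, scaledMoment s (q.1 : Measure ℕ) z ∂μ <
      γ * scaledMoment s (Measure.dirac 1) z := by
    refine hnum.eventually_lt (ENNReal.Tendsto.const_mul hden (Or.inr hγ0)) ?_
    exact ENNReal.mul_lt_mul_left hΓ0 ENNReal.ofReal_ne_top hrγ
  obtain ⟨z₀, hz₀⟩ := eventually_atTop.1 (hev.and (eventually_gt_atTop 0))
  refine ⟨γ, hγ, z₀, fun z hz => ?_⟩
  obtain ⟨h1, h2⟩ := hz₀ z hz
  refine (tsum_trans_mul_lyapunov_le μ s h2).trans ?_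
  rw [lyapunov_eq s h2, mul_left_comm]
  exact mul_le_mul' le_rfl h1.le

lemma lyapunov_succ_lt {s : ℝ} (hs : 0 < s) (z : ℕ) : lyapunov s (z + 1) < lyapunov s z := by
  refine lintegral_strict_mono (by simp) (by fun_prop) (lyapunov_ne_top hs _) ?_
  refine (ae_restrict_iff' measurableSet_Ioo).2 (ae_of_all _ fun u hu => ?_)
  have h0 : ENNReal.ofReal (1 - u) ≠ 0 := by simpa using hu.2
  refine ENNReal.mul_lt_mul_left (by simpa using Real.rpow_pos_of_pos hu.1 _)
    ENNReal.ofReal_ne_top ?_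
  rw [pow_succ]
  conv_rhs => rw [← mul_one (ENNReal.ofReal (1 - u) ^ z)]
  exact ENNReal.mul_lt_mul_right (pow_ne_zero _ h0) (by simp) (by simpa using hu.1)

/-! ### Negative moments of the offspring mean -/

lemma abs_one_sub_exp_neg_le {c x s : ℝ} (hx : -c ≤ x) (hs : 0 ≤ s) (hs1 : s ≤ 1) :
    |1 - Real.exp (-(s * x))| ≤ s * (|x| * Real.exp |c|) := by
  have hc : 1 ≤ Real.exp |c| := Real.one_le_exp (abs_nonneg c)
  rw [← mul_assoc, ← abs_of_nonneg hs, ← abs_mul, abs_of_nonneg hs]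
  have h1 := Real.add_one_le_exp (-(s * x))
  have h2 := Real.add_one_le_exp (s * x)
  have h3 : Real.exp (-(s * x)) * Real.exp (s * x) = 1 := by rw [← Real.exp_add]; simp
  have h4 := Real.exp_pos (-(s * x))
  have h5 : Real.exp (-(s * x)) ≤ Real.exp |c| := by
    refine Real.exp_le_exp.2 ?_
    nlinarith [le_abs_self c, abs_nonneg c]
  rw [abs_le]
  have h6 := le_abs_self (s * x)
  have h7 := neg_le_abs (s * x)
  have h8 := abs_nonneg (s * x)
  constructor
  · nlinarith
  · nlinarith

/-- A random variable that is bounded below and has a positive mean satisfies `E exp (-s X) < 1`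
for small `s > 0`: the right derivative at `s = 0` is `-E X`. -/
lemma exists_integral_exp_neg_lt_one {α : Type*} [MeasurableSpace α] {μ : Measure α}
    [IsProbabilityMeasure μ] {X : α → ℝ} (hX : Integrable X μ) (hpos : 0 < ∫ a, X a ∂μ) {c : ℝ}
    (hc : ∀ᵐ a ∂μ, -c ≤ X a) :
    ∃ s : ℝ, 0 < s ∧ ∫⁻ a, ENNReal.ofReal (Real.exp (-(s * X a))) ∂μ < 1 := by
  set s : ℕ → ℝ := fun n => 1 / ((n : ℝ) + 1) with hs
  have hs0 : ∀ n, 0 < s n := fun n => by positivity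
  have hs1 : ∀ n, s n ≤ 1 := fun n => by
    rw [hs]
    exact (div_le_one (by positivity)).2 (by simp)
  have hslim : Tendsto s atTop (𝓝[≠] 0) :=
    tendsto_nhdsWithin_iff.2 ⟨tendsto_one_div_add_atTop_nhds_zero_nat,
      Eventually.of_forall fun n => (hs0 n).ne'⟩
  have hmeas : ∀ n, AEStronglyMeasurable (fun a => 1 - Real.exp (-(s n * X a))) μ := fun n =>
    aestronglyMeasurable_const.sub
      (Real.continuous_exp.comp_aestronglyMeasurable (hX.aestronglyMeasurable.const_mul _).neg)
  have hbound : ∀ n, ∀ᵐ a ∂μ, ‖1 - Real.exp (-(s n * X a))‖ ≤ s n * (|X a| * Real.exp |c|) := by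
    intro n
    filter_upwards [hc] with a ha using abs_one_sub_exp_neg_le ha (hs0 n).le (hs1 n)
  have hlim : Tendsto (fun n => ∫ a, (s n)⁻¹ * (1 - Real.exp (-(s n * X a))) ∂μ) atTop
      (𝓝 (∫ a, X a ∂μ)) := by
    refine tendsto_integral_of_dominated_convergence (fun a => |X a| * Real.exp |c|)
      (fun n => (hmeas n).const_mul _) (hX.abs.mul_const _) (fun n => ?_) (ae_of_all _ fun a => ?_)
    · filter_upwards [hbound n] with a ha
      rw [norm_mul, Real.norm_of_nonneg (inv_nonneg.2 (hs0 n).le), inv_mul_le_iff₀ (hs0 n)]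
      exact ha
    · have hd : HasDerivAt (fun t : ℝ => 1 - Real.exp (-(t * X a))) (X a) 0 := by
        have h := (((hasDerivAt_id (0 : ℝ)).mul_const (X a)).fun_neg.exp).const_sub 1
        simpa using h
      have h := hd.tendsto_slope.comp hslim
      refine h.congr fun n => ?_
      simp [slope_def_field, div_eq_inv_mul]
  obtain ⟨n, hn⟩ := (hlim.eventually_const_lt hpos).exists
  rw [integral_const_mul] at hn
  have hn' := pos_of_mul_pos_right hn (inv_nonneg.2 (hs0 n).le)
  have hint : Integrable (fun a => 1 - Real.exp (-(s n * X a))) μ :=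
    ((hX.abs.mul_const _).const_mul _).mono' (hmeas n) (hbound n)
  have hint' : Integrable (fun a => Real.exp (-(s n * X a))) μ := by
    refine ((integrable_const (1 : ℝ)).sub hint).congr (ae_of_all _ fun a => ?_)
    simp
  refine ⟨s n, hs0 n, ?_⟩
  rw [integral_sub (integrable_const _) hint'] at hn'
  rw [← ofReal_integral_eq_lintegral_ofReal hint' (ae_of_all _ fun a => (Real.exp_pos _).le)]
  rw [ENNReal.ofReal_lt_one]
  simpa using hn'

lemma one_sub_le_offspringMean (q : Env) :
    1 - (q.1 : Measure ℕ) {0} ≤ offspringMean q := by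
  rw [← prob_compl_eq_one_sub (measurableSet_singleton 0), offspringMean,
    ← lintegral_countable' (μ := (q.1 : Measure ℕ)) fun j : ℕ => (j : ℝ≥0∞), ← setLIntegral_one]
  refine (setLIntegral_mono' (measurableSet_singleton 0).compl fun j hj => ?_).trans
    (setLIntegral_le_lintegral _ _)
  exact_mod_cast Nat.one_le_iff_ne_zero.2 hj

lemma exists_lintegral_offspringMean_rpow_lt_one {μ : Measure Env} [IsProbabilityMeasure μ]
    (hmean : ∀ᵐ q ∂μ, 0 < offspringMean q ∧ offspringMean q < ∞)
    (hint : Integrable (fun q => Real.log (offspringMean q).toReal) μ)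
    (hsuper : 0 < ∫ q, Real.log (offspringMean q).toReal ∂μ) {δ : ℝ} (hδ : δ < 1)
    (hB : ∀ᵐ q ∂μ, (q.1 : Measure ℕ).real {0} < δ) :
    ∃ s : ℝ, 0 < s ∧ ∫⁻ q, ENNReal.ofReal ((offspringMean q).toReal ^ (-s)) ∂μ < 1 := by
  obtain ⟨s, hs, h⟩ := exists_integral_exp_neg_lt_one hint hsuper (c := -Real.log (1 - δ)) (by
    filter_upwards [hB, hmean] with q hq hm
    rw [neg_neg]
    refine Real.log_le_log (by linarith) ?_
    have h1 := ENNReal.toReal_mono hm.2.ne (one_sub_le_offspringMean q)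
    rw [ENNReal.toReal_sub_of_le prob_le_one ENNReal.one_ne_top, ENNReal.toReal_one] at h1
    have : ((q.1 : Measure ℕ) {0}).toReal < δ := hq
    linarith)
  refine ⟨s, hs, (lintegral_congr_ae ?_).trans_lt h⟩
  filter_upwards [hmean] with q hm
  rw [Real.rpow_def_of_pos (ENNReal.toReal_pos hm.1.ne' hm.2.ne), mul_neg, mul_comm]

/-! ### Exponential rates -/

/-- Sequences that agree up to shifts of the time and up to subexponential factors have the same
exponential rate. -/
lemma tendsto_log_div_of_compare {t x α β : ℕ → ℝ} {ϱ : ℝ} (ht : ∀ n, 0 < t n)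
    (hlim : Tendsto (fun n : ℕ => Real.log (t n) / n) atTop (𝓝 ϱ)) {a b : ℕ}
    (hα : Tendsto (fun n : ℕ => α n / n) atTop (𝓝 0))
    (hβ : Tendsto (fun n : ℕ => β n / n) atTop (𝓝 0))
    (hlow : ∀ᶠ n in atTop, Real.exp (α n) * t n ≤ x (n + a))
    (hup : ∀ᶠ n in atTop, Real.exp (β n) * x n ≤ t (n + b)) :
    Tendsto (fun n : ℕ => (1 / (n : ℝ)) * Real.log (x n)) atTop (𝓝 ϱ) := by
  -- dividing by `n + a` instead of `n` does not change the limit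
  have hshift : ∀ (u : ℕ → ℝ) (l : ℝ), Tendsto (fun n : ℕ => u n / n) atTop (𝓝 l) → ∀ d e : ℕ,
      Tendsto (fun n : ℕ => u (n + d) / ((n + e : ℕ) : ℝ)) atTop (𝓝 l) := by
    intro u l hu d e
    have h1 := (tendsto_add_atTop_iff_nat d).2 hu
    have h2 : Tendsto (fun n : ℕ => ((n + d : ℕ) : ℝ) / ((n + e : ℕ) : ℝ)) atTop (𝓝 1) := by
      have h3 : Tendsto (fun n : ℕ => 1 + ((d : ℝ) - e) / ((n + e : ℕ) : ℝ)) atTop (𝓝 (1 + 0)) :=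
        tendsto_const_nhds.add (tendsto_const_nhds.div_atTop
          ((tendsto_add_atTop_iff_nat e).2 tendsto_natCast_atTop_atTop))
      rw [add_zero] at h3
      refine h3.congr' ?_
      filter_upwards [eventually_gt_atTop 0] with n hn
      have : ((n + e : ℕ) : ℝ) ≠ 0 := by positivity
      field_simp
      push_cast
      ring
    have h4 := h1.mul h2
    rw [mul_one] at h4
    refine h4.congr' ?_
    filter_upwards [eventually_gt_atTop 0] with n hn
    have h5 : ((n + d : ℕ) : ℝ) ≠ 0 := by positivity
    have h6 : ((n + e : ℕ) : ℝ) ≠ 0 := by positivity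
    field_simp
  rw [← tendsto_add_atTop_iff_nat a]
  have hlo : Tendsto (fun n : ℕ => (α n + Real.log (t n)) / ((n + a : ℕ) : ℝ)) atTop (𝓝 ϱ) := by
    have h := (hshift α 0 hα 0 a).add (hshift _ ϱ hlim 0 a)
    simpa [add_div] using h
  have hhi : Tendsto (fun n : ℕ => (Real.log (t (n + a + b)) - β (n + a)) / ((n + a : ℕ) : ℝ))
      atTop (𝓝 ϱ) := by
    have h := (hshift _ ϱ hlim (a + b) a).sub (hshift β 0 hβ a a)
    simpa [sub_div, add_assoc] using h
  refine tendsto_of_tendsto_of_tendsto_of_le_of_le' hlo hhi ?_ ?_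
  · filter_upwards [hlow] with n hn
    rw [one_div, ← div_eq_inv_mul]
    refine div_le_div_of_nonneg_right ?_ (Nat.cast_nonneg _)
    rw [← Real.log_exp (α n), ← Real.log_mul (Real.exp_pos _).ne' (ht n).ne']
    exact Real.log_le_log (mul_pos (Real.exp_pos _) (ht n)) hn
  · filter_upwards [hlow, (tendsto_add_atTop_nat a).eventually hup] with n hn hn'
    have hx : 0 < x (n + a) := (mul_pos (Real.exp_pos _) (ht n)).trans_le hn
    rw [one_div, ← div_eq_inv_mul]
    refine div_le_div_of_nonneg_right ?_ (Nat.cast_nonneg _)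
    have h := Real.log_le_log (mul_pos (Real.exp_pos _) hx) hn'
    rw [Real.log_mul (Real.exp_pos _).ne' hx.ne', Real.log_exp] at h
    linarith

/-- Supermultiplicative sequences in `(0, 1]` have an exponential rate. -/
lemma exists_tendsto_log_div {t : ℕ → ℝ} (h0 : ∀ n, 0 < t n) (h1 : ∀ n, t n ≤ 1)
    (hmul : ∀ m n, t m * t n ≤ t (m + n)) :
    ∃ ϱ, Tendsto (fun n : ℕ => Real.log (t n) / n) atTop (𝓝 ϱ) := by
  have hsub : Subadditive fun n => -Real.log (t n) := by
    intro m n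
    have := Real.log_le_log (mul_pos (h0 m) (h0 n)) (hmul m n)
    rw [Real.log_mul (h0 m).ne' (h0 n).ne'] at this
    linarith
  have hbdd : BddBelow (Set.range fun n : ℕ => -Real.log (t n) / n) := by
    refine ⟨0, ?_⟩
    rintro _ ⟨n, rfl⟩
    exact div_nonneg (neg_nonneg.2 (Real.log_nonpos (h0 n).le (h1 n))) (Nat.cast_nonneg n)
  refine ⟨-hsub.lim, ?_⟩
  simpa [neg_div] using (hsub.tendsto_lim hbdd).neg

/-- The exponential rate is negative if there is geometric decay along an arithmetic progression. -/
lemma rate_neg {t : ℕ → ℝ} {ϱ : ℝ} (h0 : ∀ n, 0 < t n)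
    (hlim : Tendsto (fun n : ℕ => Real.log (t n) / n) atTop (𝓝 ϱ)) {m : ℕ} (hm : 0 < m) {γ : ℝ}
    (hγ : γ < 1) (h : ∀ n, t (n * m) ≤ γ ^ n) : ϱ < 0 := by
  have hγ0 : 0 < γ := by simpa using (h0 _).trans_le (h 1)
  have hm' : (0 : ℝ) < m := by positivity
  have h2 := hlim.comp (tendsto_id.atTop_mul_const' (α := ℕ) hm)
  refine lt_of_le_of_lt (le_of_tendsto h2 (b := Real.log γ / m) ?_)
    (div_neg_of_neg_of_pos (Real.log_neg hγ0 hγ) hm')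
  filter_upwards [eventually_gt_atTop 0] with n hn
  have hn' : (0 : ℝ) < n := by positivity
  have h3 := Real.log_le_log (h0 _) (h n)
  rw [Real.log_pow] at h3
  simp only [Function.comp_apply, id_eq, Nat.cast_mul]
  rw [div_le_div_iff₀ (by positivity) hm']
  nlinarith

/-! ### Conclusion -/

lemma toReal_iter_mul_le (μ : Measure Env) [IsProbabilityMeasure μ] (m n k z j : ℕ) :
    (iter μ m k z).toReal * (iter μ n z j).toReal ≤ (iter μ (m + n) k j).toReal := by
  rw [← ENNReal.toReal_mul]
  exact ENNReal.toReal_mono (iter_ne_top _ _ _ _) (iter_mul_le μ m n k z j)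

lemma toReal_iter_mul_mul_le (μ : Measure Env) [IsProbabilityMeasure μ] (m n l k y z j : ℕ) :
    (iter μ m k y).toReal * (iter μ l z j).toReal * (iter μ n y z).toReal ≤
      (iter μ (n + (m + l)) k j).toReal := by
  calc (iter μ m k y).toReal * (iter μ l z j).toReal * (iter μ n y z).toReal
      = (iter μ m k y).toReal * (iter μ n y z).toReal * (iter μ l z j).toReal := by ring
    _ ≤ (iter μ (m + n) k z).toReal * (iter μ l z j).toReal :=
        mul_le_mul_of_nonneg_right (toReal_iter_mul_le μ m n k y z) ENNReal.toReal_nonneg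
    _ ≤ (iter μ (m + n + l) k j).toReal := toReal_iter_mul_le μ (m + n) l k z j
    _ = _ := by rw [show m + n + l = n + (m + l) by omega]

/-- All entries of the powers of the annealed transition matrix have the same exponential rate. -/
lemma tendsto_log_iter {μ : Measure Env} [IsProbabilityMeasure μ]
    (hcomm : ∀ k j, ∃ n, iter μ n k j ≠ 0) (hpos : ∀ n, 0 < (iter μ n 1 1).toReal) {ϱ : ℝ}
    (hlim : Tendsto (fun n : ℕ => Real.log (iter μ n 1 1).toReal / n) atTop (𝓝 ϱ)) (k j : ℕ) :
    Tendsto (fun n : ℕ => (1 / (n : ℝ)) * Real.log (iter μ n k j).toReal) atTop (𝓝 ϱ) := by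
  have hc : ∀ k j, ∃ n, 0 < (iter μ n k j).toReal := fun k j => by
    obtain ⟨n, hn⟩ := hcomm k j
    exact ⟨n, ENNReal.toReal_pos hn (iter_ne_top _ _ _ _)⟩
  obtain ⟨a₁, ha₁⟩ := hc k 1
  obtain ⟨a₂, ha₂⟩ := hc 1 j
  obtain ⟨b₁, hb₁⟩ := hc 1 k
  obtain ⟨b₂, hb₂⟩ := hc j 1
  have hconst : ∀ r : ℝ, Tendsto (fun n : ℕ => r / (n : ℝ)) atTop (𝓝 0) := fun r =>
    tendsto_const_nhds.div_atTop tendsto_natCast_atTop_atTop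
  refine tendsto_log_div_of_compare hpos hlim (a := a₁ + a₂) (b := b₁ + b₂)
    (α := fun _ => Real.log ((iter μ a₁ k 1).toReal * (iter μ a₂ 1 j).toReal))
    (β := fun _ => Real.log ((iter μ b₁ 1 k).toReal * (iter μ b₂ j 1).toReal))
    (hconst _) (hconst _) (Eventually.of_forall fun n => ?_) (Eventually.of_forall fun n => ?_)
  · rw [Real.exp_log (mul_pos ha₁ ha₂)]
    exact toReal_iter_mul_mul_le μ a₁ n a₂ k 1 1 j
  · rw [Real.exp_log (mul_pos hb₁ hb₂)]
    exact toReal_iter_mul_mul_le μ b₁ n b₂ 1 k j 1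

lemma measure_process_mem_eq {Ω : Type*} [MeasurableSpace Ω] {P : Measure Ω} {μ : Measure Env}
    {k : ℕ} [IsProbabilityMeasure P] {Q : ℕ → Ω → Env} {Z : ℕ → Ω → ℕ} (h : IsBPIRE P μ k Q Z)
    (n : ℕ) (S : Set ℕ) : P {ω | Z n ω ∈ S} = ∑' z, S.indicator (iter μ n k) z := by
  have h1 := Measure.tsum_indicator_apply_singleton (P.map (Z n)) S S.to_countable.measurableSet
  rw [Measure.map_apply (h.measurable_process n) S.to_countable.measurableSet] at h1
  refine Eq.trans h1.symm (tsum_congr fun z => ?_)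
  congr 1
  ext z
  rw [Measure.map_apply (h.measurable_process n) (measurableSet_singleton z)]
  exact measure_process_eq h n z

/-- A population of size between `1` and `κ` can shrink to `1` in one generation at a cost that is
exponential in `κ` only. -/
lemma exp_mul_measure_le_iter {Ω : Type*} [MeasurableSpace Ω] {P : Measure Ω} {μ : Measure Env}
    {k : ℕ} [IsProbabilityMeasure P] [IsProbabilityMeasure μ] {Q : ℕ → Ω → Env} {Z : ℕ → Ω → ℕ}
    (h : IsBPIRE P μ k Q Z) {c ε : ℝ} (hc : 0 < c) (hε : 0 < ε) (hε1 : ε ≤ 1)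
    (hcε : ∀ z j, j ≤ z → ENNReal.ofReal (ε ^ (z + 1) * c) ≤ trans μ z j) (n : ℕ) (κ : ℝ) :
    Real.exp (Real.log c + (κ + 1) * Real.log ε) * P.real {ω | 1 ≤ Z n ω ∧ (Z n ω : ℝ) ≤ κ} ≤
      (iter μ (n + 1) k 1).toReal := by
  have hE : ENNReal.ofReal (Real.exp (Real.log c + (κ + 1) * Real.log ε)) *
      P {ω | 1 ≤ Z n ω ∧ (Z n ω : ℝ) ≤ κ} ≤ iter μ (n + 1) k 1 := by
    have h1 := measure_process_mem_eq h n {z | 1 ≤ z ∧ (z : ℝ) ≤ κ}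
    simp only [Set.mem_ofPred_eq] at h1
    rw [h1, ← ENNReal.tsum_mul_left, iter]
    refine ENNReal.tsum_le_tsum fun z => ?_
    by_cases hz : z ∈ {z : ℕ | 1 ≤ z ∧ (z : ℝ) ≤ κ}
    · rw [Set.indicator_of_mem hz, mul_comm]
      refine mul_le_mul' le_rfl (le_trans (ENNReal.ofReal_le_ofReal ?_) (hcε z 1 hz.1))
      rw [Real.exp_add, Real.exp_log hc, mul_comm]
      refine mul_le_mul_of_nonneg_right ?_ hc.le
      rw [← Real.exp_log (pow_pos hε (z + 1)), Real.log_pow]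
      refine Real.exp_le_exp.2 (mul_le_mul_of_nonpos_right ?_ (Real.log_nonpos hε.le hε1))
      push_cast
      linarith [hz.2]
    · rw [Set.indicator_of_notMem hz, mul_zero]
      exact zero_le
  have := ENNReal.toReal_mono (iter_ne_top _ _ _ _) hE
  rwa [ENNReal.toReal_mul, ENNReal.toReal_ofReal (Real.exp_pos _).le] at this

end BPIRE

theorem theorem3p1
    -- `μ` is the law of the environment component `(f, h)`; no independence of `f` and `h`.
    (μ : Measure BPIRE.Env) [IsProbabilityMeasure μ]
    -- standing assumptions: `0 < 𝔪(f) < ∞` a.s., `E log 𝔪(f) ∈ (0, ∞)`, `P(h(0) < 1) > 0`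
    (hmean : ∀ᵐ q ∂μ, 0 < BPIRE.offspringMean q ∧ BPIRE.offspringMean q < ∞)
    (hint : Integrable (fun q => Real.log (BPIRE.offspringMean q).toReal) μ)
    (hsuper : 0 < ∫ q, Real.log (BPIRE.offspringMean q).toReal ∂μ)
    (himm : 0 < μ {q | (q.2 : Measure ℕ) {0} < 1})
    -- Assumption (A)
    (hA : 0 < μ {q | 0 < (q.2 : Measure ℕ) {0} ∧ 0 < (q.1 : Measure ℕ) {0} ∧
      0 < (q.1 : Measure ℕ) {1}})
    -- Assumption (B)
    (hB : ∃ δ : ℝ, 0 < δ ∧ δ < 1 ∧ ∀ᵐ q ∂μ, (q.1 : Measure ℕ).real {0} < δ) :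
    ∃ ϱ : ℝ, ϱ < 0 ∧
      (∀ k j : ℕ, 1 ≤ k → 1 ≤ j →
        ∀ (Ω : Type*) [MeasurableSpace Ω] (P : Measure Ω) [IsProbabilityMeasure P]
          (Q : ℕ → Ω → BPIRE.Env) (Z : ℕ → Ω → ℕ), BPIRE.IsBPIRE P μ k Q Z →
          Tendsto (fun n : ℕ => (1 / (n : ℝ)) * Real.log (P.real {ω | Z n ω = j}))
            atTop (𝓝 ϱ)) ∧
      (∀ K : ℕ → ℝ, (∀ᶠ n in atTop, 1 ≤ K n) →
        Tendsto (fun n : ℕ => K n / (n : ℝ)) atTop (𝓝 0) →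
        ∀ (Ω : Type*) [MeasurableSpace Ω] (P : Measure Ω) [IsProbabilityMeasure P]
          (Q : ℕ → Ω → BPIRE.Env) (Z : ℕ → Ω → ℕ), BPIRE.IsBPIRE P μ 1 Q Z →
          Tendsto (fun n : ℕ => (1 / (n : ℝ)) *
            Real.log (P.real {ω | 1 ≤ Z n ω ∧ (Z n ω : ℝ) ≤ K n})) atTop (𝓝 ϱ)) := by
  obtain ⟨δ, -, hδ, hB⟩ := hB
  have hcomm := BPIRE.exists_iter_ne_zero hsuper himm hA
  obtain ⟨c, ε, hc, hε, hε1, hcε⟩ := BPIRE.exists_le_trans hA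
  set t : ℕ → ℝ := fun n => (BPIRE.iter μ n 1 1).toReal with ht
  have hpos : ∀ n, 0 < t n := by
    have h1 : BPIRE.iter μ 1 1 1 ≠ 0 := by
      rw [BPIRE.iter_one]
      exact ((ENNReal.ofReal_pos.2 (by positivity)).trans_le (hcε 1 1 le_rfl)).ne'
    intro n
    refine ENNReal.toReal_pos ?_ (BPIRE.iter_ne_top _ _ _ _)
    induction n with
    | zero => simp [BPIRE.iter]
    | succ n ih => exact BPIRE.iter_add_ne_zero ih h1
  obtain ⟨ϱ, hϱ⟩ := BPIRE.exists_tendsto_log_div hpos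
    (fun n => by simpa using ENNReal.toReal_mono ENNReal.one_ne_top (BPIRE.iter_le_one μ n 1 1))
    (fun m n => BPIRE.toReal_iter_mul_le μ m n 1 1 1)
  obtain ⟨s, hs, hlt⟩ :=
    BPIRE.exists_lintegral_offspringMean_rpow_lt_one hmean hint hsuper hδ hB
  obtain ⟨γ, hγ, z₀, hV⟩ := BPIRE.exists_lyapunov_contraction hmean hδ hB hs hlt
  obtain ⟨m, γ', hm, hγ', hdecay⟩ := BPIRE.exists_iter_le_pow hcomm (BPIRE.lyapunov_antitone s)
    (BPIRE.lyapunov_ne_zero s) (BPIRE.lyapunov_ne_top hs) (BPIRE.lyapunov_succ_lt hs z₀) hγ hV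
  have hγ'top : γ' ≠ ∞ := (hγ'.trans ENNReal.one_lt_top).ne
  refine ⟨ϱ, BPIRE.rate_neg hpos hϱ hm (γ := γ'.toReal) ?_ fun n => ?_, ?_, ?_⟩
  · simpa using (ENNReal.toReal_lt_toReal hγ'top ENNReal.one_ne_top).2 hγ'
  · rw [← ENNReal.toReal_pow]
    exact ENNReal.toReal_mono (ENNReal.pow_ne_top hγ'top) (hdecay n)
  · intro k j _ _ Ω _ P _ Q Z h
    simp_rw [Measure.real, BPIRE.measure_process_eq h]
    exact BPIRE.tendsto_log_iter hcomm hpos hϱ k j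
  · intro K hK hK0 Ω _ P _ Q Z h
    have hinv : ∀ r : ℝ, Tendsto (fun n : ℕ => r / (n : ℝ)) atTop (𝓝 0) := fun r =>
      tendsto_const_nhds.div_atTop tendsto_natCast_atTop_atTop
    refine BPIRE.tendsto_log_div_of_compare hpos hϱ (a := 0) (b := 1) (α := fun _ => 0)
      (β := fun n => Real.log c + (K n + 1) * Real.log ε) (hinv 0) ?_ ?_
      (Eventually.of_forall fun n => BPIRE.exp_mul_measure_le_iter h hc hε hε1 hcε n (K n))
    · have h1 := (hinv (Real.log c)).add ((hK0.add (hinv 1)).mul_const (Real.log ε))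
      rw [add_zero, zero_mul, add_zero] at h1
      refine h1.congr fun n => ?_
      ring
    · filter_upwards [hK] with n hn
      rw [Real.exp_zero, one_mul]
      refine ENNReal.toReal_mono (measure_ne_top _ _) ?_
      rw [← BPIRE.measure_process_eq h]
      refine measure_mono fun ω hω => ?_
      have hω' : Z n ω = 1 := hω
      simpa [hω'] using hn
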